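/- The norm of a vector $x\in\mathbb{Z}^3$ is the square $\|x\|^2$ of its Euclidean length, and two vectors of $\mathbb{Z}^3$ are called twins if they are orthogonal and have the same length. A positive integer $M$ is called twin-complete if there is a vector in $\mathbb{Z}^3$ with norm $M$ (equivalently, $M$ is not of the form $4^n(8k+7)$ with integers $n,k\ge 0$) and every vector in $\mathbb{Z}^3$ with norm $M$ has a twin in $\mathbb{Z}^3$. The squarefree part of a positive integer $M$ is the unique squarefree positive integer $n$ such that $M=nm^2$ for some integer $m>0$. A positive integer is twin-complete if and only if its squarefree part is twin-complete. A positive squarefree integer is twin-complete if and only if it can be written as a sum of at most two positive squares, but not as a sum of three positive squares (where "positive squares" are squares of positive integers). -/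

import Mathlib

/-- The norm of a vector of `ℤ³`, i.e. the square of its Euclidean length. -/
def vecNorm (x : Fin 3 → ℤ) : ℤ := x ⬝ᵥ x

/-- Two vectors of `ℤ³` are twins if they have the same length and are orthogonal. -/
def AreTwins (x y : Fin 3 → ℤ) : Prop := vecNorm x = vecNorm y ∧ x ⬝ᵥ y = 0

/-- A positive integer `M` is twin-complete if every vector of `ℤ³` with norm `M` has a twin,
and there is a vector of norm `M`. -/
def TwinComplete (M : ℕ) : Prop :=
  0 < M ∧ (∀ x : Fin 3 → ℤ, vecNorm x = M → ∃ y : Fin 3 → ℤ, AreTwins x y) ∧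
    ∃ x : Fin 3 → ℤ, vecNorm x = M

/-- The squarefree part of a positive integer `M`: the product of the primes that divide `M`
to an odd power. -/
def squarefreePart (M : ℕ) : ℕ := ∏ p ∈ M.primeFactors with Odd (M.factorization p), p

/-- `n` is a sum of exactly `k` positive squares. -/
def IsSumOfPosSquares (k n : ℕ) : Prop :=
  ∃ a : Fin k → ℕ, (∀ i, 0 < a i) ∧ ∑ i, a i ^ 2 = n

/-- If `M = n * m ^ 2` with `n` squarefree and `m` positive, then `n` is the squarefree part. -/
theorem squarefreePart_eq {n m : ℕ} (hn : Squarefree n) (hm : 0 < m) :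
    squarefreePart (n * m ^ 2) = n := by
  have hn0 : n ≠ 0 := hn.ne_zero
  have hm0 : m ^ 2 ≠ 0 := by positivity
  have key : (n * m ^ 2).primeFactors.filter
      (fun p => Odd ((n * m ^ 2).factorization p)) = n.primeFactors := by
    ext p
    have hle : n.factorization p ≤ 1 := (Nat.squarefree_iff_factorization_le_one hn0).1 hn p
    have hf : (n * m ^ 2).factorization p = n.factorization p + 2 * m.factorization p := by
      rw [Nat.factorization_mul hn0 hm0, Nat.factorization_pow]
      simp
    rw [Finset.mem_filter, ← Nat.support_factorization, ← Nat.support_factorization,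
      Finsupp.mem_support_iff, Finsupp.mem_support_iff, hf]
    constructor
    · rintro ⟨-, h⟩ h0
      rw [h0, zero_add] at h
      exact (Nat.not_odd_iff_even.2 (even_two_mul _)) h
    · intro h
      have h1 : n.factorization p = 1 := by omega
      rw [h1]
      exact ⟨by omega, ⟨m.factorization p, by omega⟩⟩
  unfold squarefreePart
  rw [key]
  exact Nat.prod_primeFactors_of_squarefree hn

/-!
Vectors of `ℤ³` are treated as pure integral quaternions. For a quaternion `q` of norm `p`, the map
`x ↦ q * x * star q` is `p` times a rotation; it sends vectors of norm `k` to vectors of norm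
`k * p ^ 2` and twins to twins.

Squarefree norms. If `x` and `y` are twins of squarefree norm `n`, then Lagrange's identity shows
that `n` divides their cross product, and the quotient is an integral unit vector orthogonal to `x`.
So a vector of squarefree norm has a twin exactly when one of its coordinates vanishes
(`HasTwin.exists_coord_eq_zero`, `hasTwin_of_coord_eq_zero`), which gives the second claim.

Square factors. They are added or removed one prime `p` at a time. For `p = 2` a vector whose norm
is divisible by `4` is twice another one. For odd `p` everything rests on
`intDvd_sq_star_mul_mul`: if `x` is nonzero modulo `p`, its norm is divisible by `p ^ 2`, and
`x * q` vanishes modulo `p`, then `star q * y * q` is divisible by `p ^ 2` for `y = x` and for every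
`y` orthogonal to `x` whose norm is divisible by `p ^ 2`. Modulo `p`, `x` spans an isotropic line,
all such `y` lie on it, and `q` lies in the right ideal of `x`.

* Removing `p ^ 2` (`exists_eq_conj`): Lagrange's descent, in
  `exists_normSq_eq_prime_intDvd_mul`, produces a `q` of norm `p` with `x * q` zero modulo `p`, so
  `x = q * z * star q` with `z` integral, and a twin of `z` is carried to a twin of `x`.
* Adding `p ^ 2` (`exists_not_hasTwin_mul_prime_sq`): if `x` has no twin and is nonzero modulo `p`,
  some `q` of norm `p` makes `q * x * star q` nonzero modulo `p`, and then a twin of the latter can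
  be rotated back to a twin of `x` (`HasTwin.of_conj`).
-/

/-! ### Divisibility of integral quaternions by integers -/

open Quaternion in
/-- The integral quaternion `a + b i + c j + d k`. -/
def quatOf (a b c d : ℤ) : ℍ[ℤ] := ⟨a, b, c, d⟩

section

variable (a b c d : ℤ)

@[simp] theorem re_quatOf : (quatOf a b c d).re = a := rfl
@[simp] theorem imI_quatOf : (quatOf a b c d).imI = b := rfl
@[simp] theorem imJ_quatOf : (quatOf a b c d).imJ = c := rfl
@[simp] theorem imK_quatOf : (quatOf a b c d).imK = d := rfl

end

open Quaternion in
/-- The quaternion `x` is divisible by the integer `n`, that is, `n` divides all four of its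
coordinates. -/
def IntDvd (n : ℤ) (x : ℍ[ℤ]) : Prop := ∃ c : ℍ[ℤ], x = n • c

namespace IntDvd

open Quaternion

theorem iff_coords {n : ℤ} {x : ℍ[ℤ]} :
    IntDvd n x ↔ n ∣ x.re ∧ n ∣ x.imI ∧ n ∣ x.imJ ∧ n ∣ x.imK := by
  constructor
  · rintro ⟨c, rfl⟩
    simp
  · rintro ⟨⟨a, ha⟩, ⟨b, hb⟩, ⟨c, hc⟩, ⟨d, hd⟩⟩
    exact ⟨quatOf a b c d, by ext <;> simp [-zsmul_eq_mul, *]⟩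

theorem of_smul {s n : ℤ} {x : ℍ[ℤ]} (hs : IsCoprime s n) (h : IntDvd n (s • x)) :
    IntDvd n x := by
  rw [iff_coords] at h ⊢
  simp only [re_smul, imI_smul, imJ_smul, imK_smul, smul_eq_mul] at h
  have hs' := hs.symm
  exact ⟨hs'.dvd_of_dvd_mul_left h.1, hs'.dvd_of_dvd_mul_left h.2.1,
    hs'.dvd_of_dvd_mul_left h.2.2.1, hs'.dvd_of_dvd_mul_left h.2.2.2⟩

theorem mul_left {n : ℤ} {x : ℍ[ℤ]} (y : ℍ[ℤ]) (h : IntDvd n x) : IntDvd n (y * x) := by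
  obtain ⟨c, rfl⟩ := h
  exact ⟨y * c, by rw [mul_smul_comm]⟩

theorem mul_right {n : ℤ} {x : ℍ[ℤ]} (y : ℍ[ℤ]) (h : IntDvd n x) : IntDvd n (x * y) := by
  obtain ⟨c, rfl⟩ := h
  exact ⟨c * y, by rw [smul_mul_assoc]⟩

theorem add {n : ℤ} {x y : ℍ[ℤ]} (hx : IntDvd n x) (hy : IntDvd n y) : IntDvd n (x + y) := by
  obtain ⟨c, rfl⟩ := hx
  obtain ⟨d, rfl⟩ := hy
  exact ⟨c + d, by rw [smul_add]⟩

theorem neg {n : ℤ} {x : ℍ[ℤ]} (hx : IntDvd n x) : IntDvd n (-x) := by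
  obtain ⟨c, rfl⟩ := hx
  exact ⟨-c, by rw [smul_neg]⟩

theorem smul_of_dvd {n a : ℤ} (h : n ∣ a) (x : ℍ[ℤ]) : IntDvd n (a • x) := by
  obtain ⟨c, rfl⟩ := h
  exact ⟨c • x, by rw [mul_smul]⟩

end IntDvd

open Quaternion in
theorem normSq_eq_sum (a : ℍ[ℤ]) :
    normSq a = a.re ^ 2 + a.imI ^ 2 + a.imJ ^ 2 + a.imK ^ 2 := normSq_def' a

open Quaternion in
theorem normSq_zsmul (m : ℤ) (a : ℍ[ℤ]) : normSq (m • a) = m ^ 2 * normSq a := by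
  simp only [normSq_eq_sum, re_smul, imI_smul, imJ_smul, imK_smul, smul_eq_mul]
  ring

open Quaternion in
theorem mul_star_eq_smul (a : ℍ[ℤ]) : a * star a = normSq a • (1 : ℍ[ℤ]) := by
  rw [self_mul_star]; ext <;> simp

open Quaternion in
theorem star_mul_eq_smul (a : ℍ[ℤ]) : star a * a = normSq a • (1 : ℍ[ℤ]) := by
  rw [star_mul_self]; ext <;> simp

/-! ### Isotropic vectors modulo an odd prime -/

theorem isCoprime_of_prime {p : ℕ} (hp : p.Prime) {s : ℤ} (h : ¬ (p : ℤ) ∣ s) :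
    IsCoprime s p :=
  ((Nat.prime_iff_prime_int.1 hp).coprime_iff_not_dvd.2 h).symm

theorem not_dvd_two {p : ℕ} (hp : p.Prime) (hp2 : p ≠ 2) : ¬ (p : ℤ) ∣ 2 := fun h =>
  hp2 ((Nat.prime_dvd_prime_iff_eq hp Nat.prime_two).1 (by exact_mod_cast h))

open Quaternion in
theorem star_eq_neg_of_re {x : ℍ[ℤ]} (hx : x.re = 0) : star x = -x := by
  ext <;> simp [hx]

open Quaternion in
/-- If `x` is a pure quaternion, nonzero modulo `p`, then any `q` with `x * q ≡ 0` lies in the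
right ideal generated by `x` modulo `p`. The reason: some `e ∈ {i, j, k}` makes
`x * e + e * x` an integer `s` prime to `p`, and `s • q = x * e * q + e * (x * q)`. -/
theorem exists_smul_eq_mul_add {p : ℕ} (hp : p.Prime) (hp2 : p ≠ 2) {x q : ℍ[ℤ]}
    (hx : x.re = 0) (hpx : ¬ IntDvd p x) (hq : IntDvd p (x * q)) :
    ∃ (s : ℤ) (α β : ℍ[ℤ]), IsCoprime s p ∧ s • q = x * α + (p : ℤ) • β := by
  have key : ∀ (t : ℤ) (e : ℍ[ℤ]), ¬ (p : ℤ) ∣ t → x * e + e * x = (-2 * t : ℤ) • (1 : ℍ[ℤ]) →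
      ∃ (s : ℤ) (α β : ℍ[ℤ]), IsCoprime s p ∧ s • q = x * α + (p : ℤ) • β := by
    intro t e ht he
    obtain ⟨c, hc⟩ := hq
    refine ⟨-2 * t, e * q, e * c, isCoprime_of_prime hp ?_, ?_⟩
    · intro h
      rcases (Nat.prime_iff_prime_int.1 hp).dvd_or_dvd h with h | h
      · exact not_dvd_two hp hp2 ((dvd_neg).1 h)
      · exact ht h
    · rw [← mul_smul_comm, ← hc, ← one_mul q, ← smul_mul_assoc, ← he]
      noncomm_ring
  have comm : ∀ b c d : ℤ, x * quatOf 0 b c d + quatOf 0 b c d * x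
      = (-2 * (x.imI * b + x.imJ * c + x.imK * d) : ℤ) • (1 : ℍ[ℤ]) := by
    intro b c d
    ext <;> simp only [re_add, imI_add, imJ_add, imK_add, re_mul, imI_mul, imJ_mul, imK_mul,
      re_smul, imI_smul, imJ_smul, imK_smul, re_one, imI_one, imJ_one, imK_one, smul_eq_mul,
      re_quatOf, imI_quatOf, imJ_quatOf, imK_quatOf, hx] <;> ring
  rw [IntDvd.iff_coords, hx] at hpx
  by_cases h1 : (p : ℤ) ∣ x.imI
  · by_cases h2 : (p : ℤ) ∣ x.imJ
    · have h3 : ¬ (p : ℤ) ∣ x.imK := fun h3 => hpx ⟨dvd_zero _, h1, h2, h3⟩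
      exact key _ (quatOf 0 0 0 1) h3 (by rw [comm]; congr 1; simp)
    · exact key _ (quatOf 0 0 1 0) h2 (by rw [comm]; congr 1; simp)
  · exact key _ (quatOf 0 1 0 0) h1 (by rw [comm]; congr 1; simp)

open Quaternion in
/-- Two orthogonal isotropic vectors are parallel modulo `p`: by Lagrange's identity the square
of each coordinate of the cross product is divisible by `p ^ 2`. -/
theorem intDvd_mul_of_isotropic {p : ℕ} {x y : ℍ[ℤ]}
    (hx : x.re = 0) (hy : y.re = 0) (hnx : (p : ℤ) ^ 2 ∣ normSq x) (hny : (p : ℤ) ^ 2 ∣ normSq y)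
    (hxy : (p : ℤ) ^ 2 ∣ (x * y).re) : IntDvd p (y * x) := by
  obtain ⟨a, ha⟩ := hnx
  obtain ⟨b, hb⟩ := hny
  obtain ⟨c, hc⟩ := hxy
  have hsq : ∀ {z u v : ℤ}, z ^ 2 = normSq x * normSq y - normSq x * v ^ 2 - normSq y * u ^ 2
      - (x * y).re ^ 2 - 2 * (x * y).re * u * v → (p : ℤ) ∣ z := by
    intro z u v h
    rw [← Int.pow_dvd_pow_iff two_ne_zero, h, ha, hb, hc]
    exact ⟨a * (p ^ 2 * b) - a * v ^ 2 - b * u ^ 2 - p ^ 2 * c ^ 2 - 2 * c * u * v, by ring⟩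
  have hre : (y * x).re = (x * y).re := by simp; ring
  rw [IntDvd.iff_coords]
  refine ⟨?_, hsq (u := x.imI) (v := y.imI) ?_, hsq (u := x.imJ) (v := y.imJ) ?_,
    hsq (u := x.imK) (v := y.imK) ?_⟩
  · rw [hre, hc]
    exact ⟨p * c, by ring⟩
  all_goals simp only [normSq_eq_sum, re_mul, imI_mul, imJ_mul, imK_mul, hx, hy]; ring

open Quaternion in
/-- Let `x` be pure and nonzero modulo `p`, with `x * q ≡ 0` modulo `p`. Conjugation by `q` makes
`x`, and every pure `y` that is orthogonal to `x` modulo `p ^ 2`, divisible by `p ^ 2`, as soon as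
their norms are. So when `q` has norm `p`, the rotation `y ↦ q⁻¹ * y * q` takes such a `y` to
`p` times an integral vector. -/
theorem intDvd_sq_star_mul_mul {p : ℕ} (hp : p.Prime) (hp2 : p ≠ 2) {x y q : ℍ[ℤ]}
    (hx : x.re = 0) (hy : y.re = 0) (hpx : ¬ IntDvd p x) (hq : IntDvd p (x * q))
    (hnx : (p : ℤ) ^ 2 ∣ normSq x) (hny : (p : ℤ) ^ 2 ∣ normSq y)
    (hxy : (p : ℤ) ^ 2 ∣ (x * y).re) : IntDvd ((p : ℤ) ^ 2) (star q * y * q) := by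
  have hp0 : (p : ℤ) ≠ 0 := by exact_mod_cast hp.ne_zero
  obtain ⟨s, α, β, hs, hsq⟩ := exists_smul_eq_mul_add hp hp2 hx hpx hq
  have hyx : IntDvd p (y * x) := intDvd_mul_of_isotropic hx hy hnx hny hxy
  obtain ⟨t, ht⟩ := hq
  obtain ⟨a, ha⟩ := hnx
  obtain ⟨c, hc⟩ := hxy
  have hxx : x * x = -(normSq x • (1 : ℍ[ℤ])) := by
    rw [← mul_star_eq_smul, star_eq_neg_of_re hx]; noncomm_ring
  have hanti : x * y = (2 * (x * y).re : ℤ) • (1 : ℍ[ℤ]) - y * x := by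
    ext <;> simp only [re_sub, imI_sub, imJ_sub, imK_sub, re_mul, imI_mul, imJ_mul, imK_mul,
      re_smul, imI_smul, imJ_smul, imK_smul, re_one, imI_one, imJ_one, imK_one, smul_eq_mul,
      hx, hy] <;> ring
  -- `y * q` vanishes modulo `p`, because `q` lies in the right ideal of `x`.
  have hyq : IntDvd p (y * q) := by
    apply IntDvd.of_smul hs
    rw [← mul_smul_comm, hsq, mul_add, ← mul_assoc]
    exact (hyx.mul_right _).add (IntDvd.mul_left _ ⟨β, rfl⟩)
  obtain ⟨t', ht'⟩ := hyq
  have hst : s • t = x * β - ((p : ℤ) * a) • α := by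
    apply smul_right_injective _ hp0
    change (p : ℤ) • s • t = (p : ℤ) • (x * β - ((p : ℤ) * a) • α)
    rw [smul_comm, ← ht, ← mul_smul_comm, hsq, mul_add, ← mul_assoc, hxx, ha]
    simp only [neg_mul, smul_mul_assoc, one_mul, mul_smul_comm]
    module
  have hyt : IntDvd p (y * t) := by
    apply IntDvd.of_smul hs
    rw [← mul_smul_comm, hst, mul_sub, ← mul_assoc, sub_eq_add_neg]
    refine (hyx.mul_right _).add (IntDvd.neg (IntDvd.mul_left _ ?_))
    exact IntDvd.smul_of_dvd (dvd_mul_right _ _) _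
  have hxt' : IntDvd p (x * t') := by
    have h : x * t' = (2 * p * c : ℤ) • q + -(y * t) := by
      apply smul_right_injective _ hp0
      change (p : ℤ) • (x * t') = (p : ℤ) • ((2 * p * c : ℤ) • q + -(y * t))
      rw [← mul_smul_comm, ← ht', ← mul_assoc, hanti, sub_mul, mul_assoc y x q, ht, hc]
      simp only [smul_mul_assoc, one_mul, mul_smul_comm]
      module
    rw [h]
    exact (IntDvd.smul_of_dvd ⟨2 * c, by ring⟩ _).add hyt.neg
  obtain ⟨w, hw⟩ := hxt'
  apply IntDvd.of_smul (s := s) (hs.pow_right)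
  have hstar : s • star q = -(star α * x) + (p : ℤ) • star β := by
    have h := congrArg star hsq
    rwa [star_add, star_mul, Quaternion.star_smul, Quaternion.star_smul, star_eq_neg_of_re hx,
      mul_neg] at h
  refine ⟨star β * t' - star α * w, ?_⟩
  rw [mul_assoc, ht', ← smul_mul_assoc, hstar, add_mul]
  simp only [neg_mul, smul_mul_assoc, mul_smul_comm]
  rw [mul_assoc, hw]
  simp only [mul_smul_comm]
  module

/-! ### Lagrange's descent -/

theorem exists_two_mul_sub_sq_lt {h : ℕ} (hodd : Odd h) (a : ℤ) :
    ∃ w : ℤ, (2 * (a - h * w)) ^ 2 < (h : ℤ) ^ 2 := by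
  have h0 : 0 < (h : ℤ) := by exact_mod_cast hodd.pos
  refine ⟨(2 * a + h) / (2 * h), ?_⟩
  have e := Int.mul_ediv_add_emod (2 * a + h) (2 * h)
  have l := Int.emod_nonneg (2 * a + h) (b := 2 * h) (by omega)
  have u := Int.emod_lt_of_pos (2 * a + h) (b := 2 * h) (by omega)
  obtain ⟨k, hk⟩ := hodd
  set w := (2 * a + h) / (2 * (h : ℤ))
  set r := (2 * a + h) % (2 * (h : ℤ))
  have e' : 2 * (h * w) + r = 2 * a + h := by rw [← e]; ring
  generalize (h : ℤ) * w = v at *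
  apply sq_lt_sq'
  · omega
  · omega

open Quaternion in
/-- Reduction modulo an odd `h` to coordinates of absolute value below `h / 2`. -/
theorem exists_normSq_sub_smul_lt {h : ℕ} (hodd : Odd h) (q : ℍ[ℤ]) :
    ∃ w : ℍ[ℤ], normSq (q - (h : ℤ) • w) < (h : ℤ) ^ 2 := by
  obtain ⟨a, ha⟩ := exists_two_mul_sub_sq_lt hodd q.re
  obtain ⟨b, hb⟩ := exists_two_mul_sub_sq_lt hodd q.imI
  obtain ⟨c, hc⟩ := exists_two_mul_sub_sq_lt hodd q.imJ
  obtain ⟨d, hd⟩ := exists_two_mul_sub_sq_lt hodd q.imK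
  refine ⟨quatOf a b c d, ?_⟩
  rw [normSq_eq_sum]
  simp only [re_sub, imI_sub, imJ_sub, imK_sub, re_smul, imI_smul, imJ_smul, imK_smul,
    smul_eq_mul, re_quatOf, imI_quatOf, imJ_quatOf, imK_quatOf]
  linarith

open Quaternion in
theorem dvd_normSq_sub_smul {h : ℤ} {q : ℍ[ℤ]} (w : ℍ[ℤ]) (hq : h ∣ normSq q) :
    h ∣ normSq (q - h • w) := by
  obtain ⟨c, hc⟩ := hq
  refine ⟨c - 2 * (q * star w).re + h * normSq w, ?_⟩
  have : normSq (q - h • w) = normSq q - 2 * h * (q * star w).re + h ^ 2 * normSq w := by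
    simp only [normSq_eq_sum, re_sub, imI_sub, imJ_sub, imK_sub, re_smul, imI_smul, imJ_smul,
      imK_smul, smul_eq_mul, re_mul, re_star, imI_star, imJ_star, imK_star]
    ring
  rw [this, hc]; ring

open Quaternion in
/-- A quaternion of even norm becomes divisible by `2` on multiplication by one of `1 + i`,
`1 + j`, `1 + k`. -/
theorem exists_mul_eq_two_smul {q : ℍ[ℤ]} (hq : 2 ∣ normSq q) :
    ∃ u q' : ℍ[ℤ], normSq u = 2 ∧ q * u = (2 : ℤ) • q' := by
  have hpar : Even (q.re + q.imI + q.imJ + q.imK) := by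
    have h := even_iff_two_dvd.2 hq
    rw [normSq_eq_sum] at h
    simpa [Int.even_add, Int.even_pow] using h
  have key : ∀ u : ℍ[ℤ], normSq u = 2 → IntDvd 2 (q * u) →
      ∃ u q' : ℍ[ℤ], normSq u = 2 ∧ q * u = (2 : ℤ) • q' := by
    rintro u hu ⟨q', h⟩
    exact ⟨u, q', hu, h⟩
  have h3 : Even (q.re + q.imI) ∧ Even (q.imJ + q.imK) ∨
      Even (q.re + q.imJ) ∧ Even (q.imI + q.imK) ∨
      Even (q.re + q.imK) ∧ Even (q.imI + q.imJ) := by grind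
  rcases h3 with h | h | h
  · refine key (quatOf 1 1 0 0) (by simp [normSq_eq_sum]) (IntDvd.iff_coords.2 ?_)
    simp; grind
  · refine key (quatOf 1 0 1 0) (by simp [normSq_eq_sum]) (IntDvd.iff_coords.2 ?_)
    simp; grind
  · refine key (quatOf 1 0 0 1) (by simp [normSq_eq_sum]) (IntDvd.iff_coords.2 ?_)
    simp; grind

open Quaternion in
/-- The right ideal `{q | x * q ≡ 0 mod p}` of an isotropic `x` contains an element of norm `p`.
Lagrange's descent for sums of four squares applies, since it only multiplies on the right and
divides by integers prime to `p`. -/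
theorem exists_normSq_eq_prime_intDvd_mul {p : ℕ} (hp : p.Prime) (hp2 : p ≠ 2) {x : ℍ[ℤ]}
    (hx : x.re = 0) (hpx : ¬ IntDvd p x) (hnx : (p : ℤ) ∣ normSq x) :
    ∃ q : ℍ[ℤ], normSq q = p ∧ IntDvd p (x * q) := by
  have hp0 : 0 < (p : ℤ) := by exact_mod_cast hp.pos
  have descent : ∀ h : ℕ, 0 < h → h < p → ∀ q : ℍ[ℤ], normSq q = h * p → IntDvd p (x * q) →
      ∃ q : ℍ[ℤ], normSq q = p ∧ IntDvd p (x * q) := by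
    intro h
    induction h using Nat.strong_induction_on with
    | _ h ih =>
    intro h0 hlt q hq hxq
    -- Quotients of right multiples of `q` by integers prime to `p` stay in the ideal.
    have quot : ∀ (m : ℤ) (u q' : ℍ[ℤ]), IsCoprime m (p : ℤ) → q * u = m • q' →
        IntDvd p (x * q') := by
      intro m u q' hm hu
      apply IntDvd.of_smul hm
      rw [← mul_smul_comm, ← hu, ← mul_assoc]
      exact hxq.mul_right u
    rcases Nat.even_or_odd h with ⟨g, hg⟩ | hodd
    · obtain ⟨u, q', hu, hq'⟩ := exists_mul_eq_two_smul (q := q)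
        (by rw [hq, hg]; push_cast; exact ⟨g * p, by ring⟩)
      have h2 : IsCoprime (2 : ℤ) p := by
        have := (Nat.coprime_primes Nat.prime_two hp).2 (Ne.symm hp2)
        exact_mod_cast Nat.isCoprime_iff_coprime.2 this
      refine ih g (by omega) (by omega) (by omega) q' ?_ (quot 2 u q' h2 hq')
      have := congrArg normSq hq'
      rw [map_mul, normSq_zsmul, hu, hq, hg] at this
      push_cast at this
      linarith
    · by_cases h1 : h = 1
      · exact ⟨q, by rw [hq, h1]; simp, hxq⟩
      obtain ⟨w, hw⟩ := exists_normSq_sub_smul_lt hodd q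
      obtain ⟨c, hc⟩ := dvd_normSq_sub_smul w (h := h) (q := q) ⟨p, hq⟩
      have hz0 : 0 < (h : ℤ) := by exact_mod_cast h0
      have hcop : IsCoprime (h : ℤ) p :=
        (Nat.isCoprime_iff_coprime.2 (Nat.coprime_of_lt_prime h0.ne' hlt hp)).symm
      have hmul : q * star (q - (h : ℤ) • w) = (h : ℤ) • ((p : ℤ) • 1 - q * star w) := by
        rw [star_sub, mul_sub, mul_star_eq_smul, hq, Quaternion.star_smul, mul_smul_comm]
        module
      have hc0 : 0 ≤ c := by
        have : 0 ≤ (h : ℤ) * c := hc ▸ normSq_nonneg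
        exact nonneg_of_mul_nonneg_right this hz0
      have hch : c < h := by
        rw [hc, sq] at hw
        exact lt_of_mul_lt_mul_left hw hz0.le
      have hcne : c ≠ 0 := by
        rintro rfl
        rw [mul_zero, normSq_eq_zero, sub_eq_zero] at hc
        have h2 : (h : ℤ) * p = (h : ℤ) * (h * normSq w) := by
          rw [← hq, hc, normSq_zsmul]
          ring
        have h3 : (h : ℤ) ∣ p := ⟨_, mul_left_cancel₀ hz0.ne' h2⟩
        rcases (Nat.dvd_prime hp).1 (by exact_mod_cast h3) with h4 | h4
        · exact h1 h4
        · omega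
      lift c to ℕ using hc0
      refine ih c (by exact_mod_cast hch) (by omega) (by omega) _ ?_ (quot h _ _ hcop hmul)
      have hn := congrArg normSq hmul
      rw [map_mul, normSq_zsmul, normSq_star, hq, hc] at hn
      apply mul_left_cancel₀ (pow_ne_zero 2 hz0.ne')
      rw [← hn]; ring
  -- The descent starts from `x` itself, reduced modulo `p`: `x * x = -normSq x`.
  obtain ⟨w, hw⟩ := exists_normSq_sub_smul_lt (hp.odd_of_ne_two hp2) x
  obtain ⟨c, hc⟩ := dvd_normSq_sub_smul w hnx
  have hc0 : 0 ≤ c := by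
    have : 0 ≤ (p : ℤ) * c := hc ▸ normSq_nonneg
    exact nonneg_of_mul_nonneg_right this hp0
  have hcp : c < p := by
    rw [hc, sq] at hw
    exact lt_of_mul_lt_mul_left hw hp0.le
  have hcne : c ≠ 0 := by
    rintro rfl
    rw [mul_zero, normSq_eq_zero, sub_eq_zero] at hc
    exact hpx ⟨w, hc⟩
  lift c to ℕ using hc0
  refine descent c (by omega) (by exact_mod_cast hcp) _ (by rw [hc, mul_comm]) ?_
  have hxx : x * x = -(normSq x • (1 : ℍ[ℤ])) := by
    rw [← mul_star_eq_smul, star_eq_neg_of_re hx]; noncomm_ring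
  rw [mul_sub, hxx, sub_eq_add_neg]
  exact (IntDvd.smul_of_dvd hnx _).neg.add (IntDvd.mul_left _ ⟨w, rfl⟩).neg

/-! ### Transport of twins along quaternions of prime norm -/

open Quaternion in
/-- The twin relation for pure quaternions, which stand for vectors of `ℤ³`: `-(x * y).re` is the
inner product of `x` and `y`. -/
def HasTwin (x : ℍ[ℤ]) : Prop := ∃ y : ℍ[ℤ], y.re = 0 ∧ normSq y = normSq x ∧ (x * y).re = 0

open Quaternion in
theorem HasTwin.smul {x : ℍ[ℤ]} (m : ℤ) (h : HasTwin x) : HasTwin (m • x) := by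
  obtain ⟨y, hy, hn, hxy⟩ := h
  refine ⟨m • y, by rw [re_smul, hy, smul_zero], by rw [normSq_zsmul, normSq_zsmul, hn], ?_⟩
  rw [smul_mul_smul_comm, re_smul, hxy, smul_zero]

open Quaternion in
theorem re_conj (q x : ℍ[ℤ]) : (q * x * star q).re = normSq q * x.re := by
  simp only [normSq_eq_sum, re_mul, imI_mul, imJ_mul, imK_mul, re_star, imI_star, imJ_star,
    imK_star]
  ring

open Quaternion in
/-- Conjugation by `q` scales inner products by `normSq q ^ 2`. -/
theorem re_conj_mul_conj (q x y : ℍ[ℤ]) :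
    ((q * x * star q) * (q * y * star q)).re = normSq q ^ 2 * (x * y).re := by
  have h : (q * x * star q) * (q * y * star q) = normSq q • (q * (x * y) * star q) := by
    have : (q * x * star q) * (q * y * star q) = q * x * (star q * q) * y * star q := by
      noncomm_ring
    rw [this, star_mul_eq_smul]
    simp only [mul_smul_comm, smul_mul_assoc, mul_one, mul_assoc]
  rw [h, re_smul, re_conj, smul_eq_mul]
  ring

open Quaternion in
theorem star_mul_conj_mul {q : ℍ[ℤ]} {n : ℤ} (hq : normSq q = n) (x : ℍ[ℤ]) :
    star q * (q * x * star q) * q = (n ^ 2) • x := by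
  have : star q * (q * x * star q) * q = (star q * q) * x * (star q * q) := by noncomm_ring
  rw [this, star_mul_eq_smul, hq]
  simp only [smul_mul_assoc, mul_smul_comm, one_mul, mul_one, smul_smul]
  rw [sq]

open Quaternion in
theorem HasTwin.conj {x : ℍ[ℤ]} (q : ℍ[ℤ]) (h : HasTwin x) : HasTwin (q * x * star q) := by
  obtain ⟨y, hy, hn, hxy⟩ := h
  refine ⟨q * y * star q, by rw [re_conj, hy, mul_zero], ?_, ?_⟩
  · simp only [map_mul, hn]
  · rw [re_conj_mul_conj, hxy, mul_zero]

open Quaternion in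
theorem HasTwin.of_smul {x : ℍ[ℤ]} {m : ℤ} (hm : m ≠ 0)
    (h : ∀ y : ℍ[ℤ], y.re = 0 → normSq y = normSq (m • x) → ((m • x) * y).re = 0 → IntDvd m y)
    (ht : HasTwin (m • x)) : HasTwin x := by
  obtain ⟨y, hy, hn, hxy⟩ := ht
  obtain ⟨z, rfl⟩ := h y hy hn hxy
  rw [re_smul, smul_eq_mul, mul_eq_zero, or_iff_right hm] at hy
  rw [normSq_zsmul, normSq_zsmul] at hn
  rw [smul_mul_smul_comm, re_smul, smul_eq_mul] at hxy
  exact ⟨z, hy, mul_left_cancel₀ (pow_ne_zero 2 hm) hn,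
    (mul_eq_zero.1 hxy).resolve_left (mul_ne_zero hm hm)⟩

open Quaternion in
/-- A sum of three squares that is divisible by `4` has even terms only. -/
theorem intDvd_two_of_four_dvd {x : ℍ[ℤ]} (hx : x.re = 0) (h : 4 ∣ normSq x) : IntDvd 2 x := by
  rw [normSq_eq_sum, hx] at h
  have sq : ∀ a : ℤ, 2 ∣ a ∧ a ^ 2 % 4 = 0 ∨ a ^ 2 % 4 = 1 := by
    intro a
    rcases Int.even_or_odd' a with ⟨k, rfl | rfl⟩
    · left; constructor
      · omega
      · ring_nf; omega
    · right; ring_nf; omega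
  rw [IntDvd.iff_coords, hx]
  have h1 := sq x.imI
  have h2 := sq x.imJ
  have h3 := sq x.imK
  refine ⟨dvd_zero _, ?_, ?_, ?_⟩ <;> omega

open Quaternion in
/-- Over an odd prime `p`, a primitive pure quaternion whose norm is divisible by `p ^ 2` comes
from one of norm smaller by `p ^ 2`, by conjugation with a quaternion of norm `p`. -/
theorem exists_eq_conj {p : ℕ} (hp : p.Prime) (hp2 : p ≠ 2) {x : ℍ[ℤ]} (hx : x.re = 0)
    (hpx : ¬ IntDvd p x) (hnx : (p : ℤ) ^ 2 ∣ normSq x) :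
    ∃ q z : ℍ[ℤ], z.re = 0 ∧ normSq x = (p : ℤ) ^ 2 * normSq z ∧ x = q * z * star q := by
  have hp0 : (p : ℤ) ≠ 0 := by exact_mod_cast hp.ne_zero
  obtain ⟨q, hq, hxq⟩ :=
    exists_normSq_eq_prime_intDvd_mul hp hp2 hx hpx ((dvd_pow_self _ two_ne_zero).trans hnx)
  have hxx : (p : ℤ) ^ 2 ∣ (x * x).re := by
    have : (x * x).re = -normSq x := by
      rw [normSq_eq_sum]; simp [hx]; ring
    rw [this]
    exact hnx.neg_right
  obtain ⟨z, hz⟩ := intDvd_sq_star_mul_mul hp hp2 hx hx hpx hxq hnx hnx hxx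
  have hxz : x = q * z * star q := by
    apply smul_right_injective _ (pow_ne_zero 2 hp0)
    change ((p : ℤ) ^ 2) • x = ((p : ℤ) ^ 2) • (q * z * star q)
    rw [← smul_mul_assoc, ← mul_smul_comm, ← hz]
    have : q * (star q * x * q) * star q = (q * star q) * x * (q * star q) := by noncomm_ring
    rw [this, mul_star_eq_smul, hq]
    simp only [smul_mul_assoc, mul_smul_comm, one_mul, mul_one, smul_smul]
    rw [sq]
  refine ⟨q, z, ?_, ?_, hxz⟩
  · have := re_conj q z
    rw [← hxz, hx, hq] at this
    exact (mul_eq_zero.1 this.symm).resolve_left hp0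
  · rw [hxz, map_mul, map_mul, normSq_star, hq]
    ring

open Quaternion in
/-- Twins are inherited from norm `k` to norm `k * p ^ 2`, and a vector of norm `k * p ^ 2`
gives one of norm `k`. -/
theorem exists_normSq_of_mul_prime_sq {p : ℕ} (hp : p.Prime) {k : ℤ} {x : ℍ[ℤ]} (hx : x.re = 0)
    (hnx : normSq x = k * (p : ℤ) ^ 2) :
    ∃ z : ℍ[ℤ], z.re = 0 ∧ normSq z = k ∧ (HasTwin z → HasTwin x) := by
  have hp0 : (p : ℤ) ≠ 0 := by exact_mod_cast hp.ne_zero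
  by_cases hpx : IntDvd p x
  · obtain ⟨z, rfl⟩ := hpx
    refine ⟨z, ?_, ?_, HasTwin.smul _⟩
    · simpa [-zsmul_eq_mul, hp.ne_zero] using hx
    · rw [normSq_zsmul, mul_comm] at hnx
      exact mul_right_cancel₀ (pow_ne_zero 2 hp0) hnx
  · have hp2 : p ≠ 2 := by
      rintro rfl
      exact hpx (intDvd_two_of_four_dvd hx ⟨k, by rw [hnx]; push_cast; ring⟩)
    obtain ⟨q, z, hz, hn, rfl⟩ := exists_eq_conj hp hp2 hx hpx ⟨k, by rw [hnx, mul_comm]⟩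
    refine ⟨z, hz, ?_, HasTwin.conj q⟩
    rw [hnx, mul_comm] at hn
    exact (mul_left_cancel₀ (pow_ne_zero 2 hp0) hn).symm

/-- Lagrange's four squares can be ordered so that `p` does not divide the sum of the first two:
otherwise it would divide all four numbers, and `p ^ 2` would divide `p`. -/
theorem exists_four_squares_not_dvd {p : ℕ} (hp : p.Prime) (hp2 : p ≠ 2) :
    ∃ a b c d : ℤ, a ^ 2 + b ^ 2 + c ^ 2 + d ^ 2 = p ∧ ¬ (p : ℤ) ∣ a ^ 2 + b ^ 2 := by
  obtain ⟨a, b, c, d, h⟩ := Nat.sum_four_squares p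
  have h : (a : ℤ) ^ 2 + b ^ 2 + c ^ 2 + d ^ 2 = p := by exact_mod_cast h
  have hP := Nat.prime_iff_prime_int.1 hp
  by_contra! hall
  obtain ⟨u, hu⟩ := hall a b c d h
  obtain ⟨v, hv⟩ := hall a c b d (by linarith)
  obtain ⟨w, hw⟩ := hall b c a d (by linarith)
  have two : ∀ {e f : ℤ}, 2 * e ^ 2 = p * f → (p : ℤ) ^ 2 ∣ e ^ 2 := by
    intro e f he
    apply pow_dvd_pow_of_dvd
    exact hP.dvd_of_dvd_pow ((hP.dvd_or_dvd ⟨f, he⟩).resolve_left (not_dvd_two hp hp2))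
  obtain ⟨a', ha⟩ := two (e := a) (f := u + v - w) (by linarith)
  obtain ⟨b', hb⟩ := two (e := b) (f := u + w - v) (by linarith)
  obtain ⟨c', hc⟩ := two (e := c) (f := v + w - u) (by linarith)
  obtain ⟨d', hd⟩ := two (e := d) (f := 2 - u - v - w) (by linarith)
  have h1 : (p : ℤ) * (p * (a' + b' + c' + d')) = p * 1 := by linarith
  have h2 := mul_left_cancel₀ hP.ne_zero h1
  exact hP.not_isUnit (IsUnit.of_mul_eq_one _ h2)

open Quaternion in
/-- For `x` pure and nonzero modulo `p`, some quaternion of norm `p` conjugates `x` to a vector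
that is still nonzero modulo `p`. -/
theorem exists_conj_not_intDvd {p : ℕ} (hp : p.Prime) (hp2 : p ≠ 2) {x : ℍ[ℤ]} (hx : x.re = 0)
    (hpx : ¬ IntDvd p x) : ∃ q : ℍ[ℤ], normSq q = p ∧ ¬ IntDvd p (q * x * star q) := by
  have hP := Nat.prime_iff_prime_int.1 hp
  obtain ⟨a, b, c, d, hsum, hab⟩ := exists_four_squares_not_dvd hp hp2
  by_contra! hall
  -- If `q` and `q * i` both kill `x = x₁ i + x₂ j + x₃ k` modulo `p`, then the sum of the two
  -- conjugates is `2 * x₁ * (q * i * star q)`, whose `i`-coordinate is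
  -- `2 * x₁ * (2 * (a ^ 2 + b ^ 2) - p)`.
  have fin : ∀ t : ℤ, (p : ℤ) ∣ 2 * (t * (2 * (a ^ 2 + b ^ 2) - p)) → (p : ℤ) ∣ t := by
    intro t ht
    have h1 := (hP.dvd_or_dvd ht).resolve_left (not_dvd_two hp hp2)
    refine (hP.dvd_or_dvd h1).resolve_right fun h2 => ?_
    have h3 := (dvd_sub_self_right).1 h2
    exact hab ((hP.dvd_or_dvd h3).resolve_left (not_dvd_two hp hp2))
  apply hpx
  rw [IntDvd.iff_coords, hx]
  refine ⟨dvd_zero _, fin _ ?_, fin _ ?_, fin _ ?_⟩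
  · have h1 := (IntDvd.iff_coords.1 (hall (quatOf a b c d)
      (by rw [normSq_eq_sum]; simpa using hsum))).2.1
    have h2 := (IntDvd.iff_coords.1 (hall (quatOf a b c d * quatOf 0 1 0 0)
      (by rw [map_mul, normSq_eq_sum, normSq_eq_sum]; simpa using hsum))).2.1
    refine (dvd_add h1 h2).trans (dvd_of_eq ?_)
    rw [← hsum]
    simp [hx]
    ring
  · have h1 := (IntDvd.iff_coords.1 (hall (quatOf a c b d)
      (by rw [normSq_eq_sum]; simp; linarith))).2.2.1
    have h2 := (IntDvd.iff_coords.1 (hall (quatOf a c b d * quatOf 0 0 1 0)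
      (by rw [map_mul, normSq_eq_sum, normSq_eq_sum]; simp; linarith))).2.2.1
    refine (dvd_add h1 h2).trans (dvd_of_eq ?_)
    rw [← hsum]
    simp [hx]
    ring
  · have h1 := (IntDvd.iff_coords.1 (hall (quatOf a c d b)
      (by rw [normSq_eq_sum]; simp; linarith))).2.2.2
    have h2 := (IntDvd.iff_coords.1 (hall (quatOf a c d b * quatOf 0 0 0 1)
      (by rw [map_mul, normSq_eq_sum, normSq_eq_sum]; simp; linarith))).2.2.2
    refine (dvd_add h1 h2).trans (dvd_of_eq ?_)
    rw [← hsum]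
    simp [hx]
    ring

open Quaternion in
/-- A twin of `q * x * star q` comes from a twin of `x` when `q` has norm `p` and
`q * x * star q` is nonzero modulo `p`. -/
theorem HasTwin.of_conj {p : ℕ} (hp : p.Prime) (hp2 : p ≠ 2) {x q : ℍ[ℤ]} (hx : x.re = 0)
    (hq : normSq q = p) (hpX : ¬ IntDvd p (q * x * star q)) (h : HasTwin (q * x * star q)) :
    HasTwin x := by
  have hp0 : (p : ℤ) ≠ 0 := by exact_mod_cast hp.ne_zero
  obtain ⟨y, hy, hn, hxy⟩ := h
  have hX : normSq (q * x * star q) = (p : ℤ) ^ 2 * normSq x := by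
    rw [map_mul, map_mul, normSq_star, hq]; ring
  have hXq : IntDvd p (q * x * star q * q) := by
    rw [mul_assoc (q * x), star_mul_eq_smul, hq, mul_smul_comm]
    exact ⟨_, rfl⟩
  obtain ⟨z, hz⟩ := intDvd_sq_star_mul_mul hp hp2 (by rw [re_conj, hx, mul_zero]) hy hpX hXq
    ⟨_, hX⟩ ⟨_, hn.trans hX⟩ (by rw [hxy]; exact dvd_zero _)
  have hback := star_mul_conj_mul hq x
  have hp20 : (p : ℤ) ^ 2 ≠ 0 := pow_ne_zero 2 hp0
  have hz' : star q * y * star (star q) = ((p : ℤ) ^ 2) • z := by rw [star_star, hz]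
  refine ⟨z, ?_, ?_, ?_⟩
  · have h := re_conj (star q) y
    rw [hz', hy, mul_zero, re_smul, smul_eq_mul] at h
    exact (mul_eq_zero.1 h).resolve_left hp20
  · have h := congrArg normSq hz
    rw [map_mul, map_mul, normSq_star, normSq_zsmul, hn, hX, hq] at h
    apply mul_left_cancel₀ (pow_ne_zero 2 hp20)
    rw [← h]
    ring
  · have h := re_conj_mul_conj (star q) (q * x * star q) y
    rw [hz', hxy, mul_zero, star_star, hback, smul_mul_smul_comm, re_smul, smul_eq_mul] at h
    exact (mul_eq_zero.1 h).resolve_left (mul_ne_zero hp20 hp20)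

open Quaternion in
/-- A vector without a twin gives one whose norm is larger by the factor `p ^ 2`. Being nonzero
modulo every odd prime is carried along, as it makes the step possible at the next prime. -/
theorem exists_not_hasTwin_mul_prime_sq {p : ℕ} (hp : p.Prime) {k : ℤ} {x : ℍ[ℤ]} (hx : x.re = 0)
    (hnx : normSq x = k) (ht : ¬ HasTwin x)
    (hprim : ∀ l : ℕ, l.Prime → l ≠ 2 → ¬ IntDvd l x) :
    ∃ z : ℍ[ℤ], z.re = 0 ∧ normSq z = k * (p : ℤ) ^ 2 ∧ ¬ HasTwin z ∧
      ∀ l : ℕ, l.Prime → l ≠ 2 → ¬ IntDvd l z := by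
  by_cases hp2 : p = 2
  · subst hp2
    have hnz : normSq ((2 : ℤ) • x) = 4 * k := by rw [normSq_zsmul, hnx]; norm_num
    refine ⟨(2 : ℤ) • x, by rw [re_smul, hx, smul_zero], by rw [hnz]; push_cast; ring, ?_, ?_⟩
    · intro h
      refine ht (HasTwin.of_smul two_ne_zero (fun y hy hn _ => ?_) h)
      exact intDvd_two_of_four_dvd hy ⟨k, hn.trans hnz⟩
    · intro l hl hl2 h
      exact hprim l hl hl2 (IntDvd.of_smul (isCoprime_of_prime hl (not_dvd_two hl hl2)) h)
  · obtain ⟨q, hq, hX⟩ := exists_conj_not_intDvd hp hp2 hx (hprim p hp hp2)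
    refine ⟨q * x * star q, by rw [re_conj, hx, mul_zero], ?_, ?_, ?_⟩
    · rw [map_mul, map_mul, normSq_star, hq, hnx]; ring
    · exact fun h => ht (HasTwin.of_conj hp hp2 hx hq hX h)
    · intro l hl hl2 h
      by_cases hlp : l = p
      · exact hX (hlp ▸ h)
      · -- Conjugating back by `star q` gives `p ^ 2 • x`.
        have hback : star q * (q * x * star q) * q = ((p : ℤ) ^ 2) • x :=
          star_mul_conj_mul hq x
        apply hprim l hl hl2
        refine IntDvd.of_smul (s := (p : ℤ) ^ 2) ?_ (hback ▸ (h.mul_left (star q)).mul_right q)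
        exact (Nat.isCoprime_iff_coprime.2 ((Nat.coprime_primes hp hl).2 (Ne.symm hlp))).pow_left

/-! ### Square factors and squarefree norms -/

open Quaternion in
theorem exists_normSq_of_mul_sq {m : ℕ} (hm : 0 < m) {k : ℤ} {x : ℍ[ℤ]} (hx : x.re = 0)
    (hnx : normSq x = k * (m : ℤ) ^ 2) :
    ∃ z : ℍ[ℤ], z.re = 0 ∧ normSq z = k ∧ (HasTwin z → HasTwin x) := by
  induction m using induction_on_primes generalizing x with
  | zero => exact absurd hm (lt_irrefl 0)
  | one => exact ⟨x, hx, by simpa using hnx, id⟩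
  | prime_mul p a hp ih =>
    obtain ⟨z, hz, hn, ht⟩ := exists_normSq_of_mul_prime_sq hp (k := k * (a : ℤ) ^ 2) hx
      (by rw [hnx]; push_cast; ring)
    obtain ⟨w, hw, hn', ht'⟩ := ih (Nat.pos_of_mul_pos_left hm) hz hn
    exact ⟨w, hw, hn', ht ∘ ht'⟩

open Quaternion in
theorem exists_not_hasTwin_mul_sq {m : ℕ} (hm : 0 < m) {k : ℤ} {x : ℍ[ℤ]} (hx : x.re = 0)
    (hnx : normSq x = k) (ht : ¬ HasTwin x)
    (hprim : ∀ l : ℕ, l.Prime → l ≠ 2 → ¬ IntDvd l x) :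
    ∃ z : ℍ[ℤ], z.re = 0 ∧ normSq z = k * (m : ℤ) ^ 2 ∧ ¬ HasTwin z := by
  induction m using induction_on_primes generalizing k x with
  | zero => exact absurd hm (lt_irrefl 0)
  | one => exact ⟨x, hx, by simpa using hnx, ht⟩
  | prime_mul p a hp ih =>
    obtain ⟨z, hz, hn, ht', hprim'⟩ := exists_not_hasTwin_mul_prime_sq hp hx hnx ht hprim
    obtain ⟨w, hw, hn', ht''⟩ := ih (Nat.pos_of_mul_pos_left hm) hz hn ht' hprim'
    exact ⟨w, hw, by rw [hn']; push_cast; ring, ht''⟩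

open Quaternion in
theorem not_intDvd_of_squarefree {n l : ℕ} (hn : Squarefree n) (hl : l.Prime) {x : ℍ[ℤ]}
    (hnx : normSq x = n) : ¬ IntDvd l x := by
  rintro ⟨c, rfl⟩
  rw [normSq_zsmul, sq] at hnx
  have h : l * l ∣ n := by
    have : ((l * l : ℕ) : ℤ) ∣ n := ⟨normSq c, by rw [← hnx]; push_cast; ring⟩
    exact_mod_cast this
  exact hl.not_isUnit (hn l h)

open Quaternion in
/-- For squarefree `n`, a vector `x` of norm `n` with a twin `y` has a zero coordinate: the cross
product of `x` and `y` has norm `n ^ 2`, it is divisible by `n`, and the quotient `w` is an integer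
unit vector orthogonal to `x`. -/
theorem HasTwin.exists_coord_eq_zero {n : ℕ} (hn : Squarefree n) {x : ℍ[ℤ]} (hx : x.re = 0)
    (hnx : normSq x = n) (h : HasTwin x) : x.imI = 0 ∨ x.imJ = 0 ∨ x.imK = 0 := by
  obtain ⟨y, hy, hny, hxy⟩ := h
  rw [hnx] at hny
  have hn0 : 0 < (n : ℤ) := by exact_mod_cast Nat.pos_of_ne_zero hn.ne_zero
  have hnz : Squarefree (n : ℤ) := Int.squarefree_natCast.2 hn
  -- Lagrange's identity divided by `n`, for each coordinate of the cross product.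
  have key : ∀ {z u v : ℤ}, z ^ 2 = normSq x * normSq y - normSq x * v ^ 2 - normSq y * u ^ 2
      - (x * y).re ^ 2 - 2 * (x * y).re * u * v →
      ∃ w : ℤ, n * w ^ 2 + u ^ 2 + v ^ 2 = n := by
    intro z u v hz
    rw [hnx, hny, hxy] at hz
    obtain ⟨w, rfl⟩ : (n : ℤ) ∣ z := by
      rw [← hnz.dvd_pow_iff_dvd two_ne_zero, hz]
      exact ⟨n - v ^ 2 - u ^ 2, by ring⟩
    refine ⟨w, mul_left_cancel₀ hn0.ne' ?_⟩
    linear_combination hz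
  obtain ⟨w₁, h₁⟩ := key (z := (x * y).imI) (u := x.imI) (v := y.imI)
    (by simp only [normSq_eq_sum, re_mul, imI_mul, hx, hy]; ring)
  obtain ⟨w₂, h₂⟩ := key (z := (x * y).imJ) (u := x.imJ) (v := y.imJ)
    (by simp only [normSq_eq_sum, re_mul, imJ_mul, hx, hy]; ring)
  obtain ⟨w₃, h₃⟩ := key (z := (x * y).imK) (u := x.imK) (v := y.imK)
    (by simp only [normSq_eq_sum, re_mul, imK_mul, hx, hy]; ring)
  have hzero : ∀ {w u v : ℤ}, n * w ^ 2 + u ^ 2 + v ^ 2 = n → u ≠ 0 → w = 0 := by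
    intro w u v h hu
    by_contra hw
    have h1 : 0 < u ^ 2 := by positivity
    have h2 : 0 < w ^ 2 := by positivity
    nlinarith [sq_nonneg v]
  rw [normSq_eq_sum, hx] at hnx
  rw [normSq_eq_sum, hy] at hny
  by_contra! hne
  rw [hzero h₁ hne.1] at h₁
  rw [hzero h₂ hne.2.1] at h₂
  rw [hzero h₃ hne.2.2] at h₃
  linarith

open Quaternion in
theorem hasTwin_of_coord_eq_zero {x : ℍ[ℤ]} (hx : x.re = 0)
    (h : x.imI = 0 ∨ x.imJ = 0 ∨ x.imK = 0) : HasTwin x := by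
  rcases h with h | h | h
  · refine ⟨quatOf 0 0 (-x.imK) x.imJ, rfl, ?_, ?_⟩
    · simp only [normSq_eq_sum, re_quatOf, imI_quatOf, imJ_quatOf, imK_quatOf, hx, h]; ring
    · simp only [re_mul, re_quatOf, imI_quatOf, imJ_quatOf, imK_quatOf, hx, h]; ring
  · refine ⟨quatOf 0 (-x.imK) 0 x.imI, rfl, ?_, ?_⟩
    · simp only [normSq_eq_sum, re_quatOf, imI_quatOf, imJ_quatOf, imK_quatOf, hx, h]; ring
    · simp only [re_mul, re_quatOf, imI_quatOf, imJ_quatOf, imK_quatOf, hx, h]; ring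
  · refine ⟨quatOf 0 (-x.imJ) x.imI 0, rfl, ?_, ?_⟩
    · simp only [normSq_eq_sum, re_quatOf, imI_quatOf, imJ_quatOf, imK_quatOf, hx, h]; ring
    · simp only [re_mul, re_quatOf, imI_quatOf, imJ_quatOf, imK_quatOf, hx, h]; ring

open Quaternion in
theorem twinComplete_iff {M : ℕ} (hM : 0 < M) : TwinComplete M ↔
    (∀ x : ℍ[ℤ], x.re = 0 → normSq x = M → HasTwin x) ∧
      ∃ x : ℍ[ℤ], x.re = 0 ∧ normSq x = M := by
  have hnorm : ∀ x : ℍ[ℤ], x.re = 0 → vecNorm ![x.imI, x.imJ, x.imK] = normSq x := by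
    intro x hx
    simp [vecNorm, normSq_eq_sum, hx, dotProduct, Fin.sum_univ_three]
    ring
  have hnorm' : ∀ v : Fin 3 → ℤ, normSq (quatOf 0 (v 0) (v 1) (v 2)) = vecNorm v := by
    intro v
    simp [vecNorm, normSq_eq_sum, dotProduct, Fin.sum_univ_three]
    ring
  constructor
  · rintro ⟨-, h, v, hv⟩
    refine ⟨fun x hx hn => ?_, quatOf 0 (v 0) (v 1) (v 2), rfl, by rw [hnorm', hv]⟩
    obtain ⟨y, hy, hxy⟩ := h ![x.imI, x.imJ, x.imK] (by rw [hnorm x hx, hn])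
    refine ⟨quatOf 0 (y 0) (y 1) (y 2), rfl, by rw [hnorm', ← hy, hnorm x hx], ?_⟩
    simp [dotProduct, Fin.sum_univ_three] at hxy
    simp [hx]
    linarith
  · rintro ⟨h, x, hx, hn⟩
    refine ⟨hM, fun v hv => ?_, ![x.imI, x.imJ, x.imK], by rw [hnorm x hx, hn]⟩
    obtain ⟨y, hy, hyn, hxy⟩ := h (quatOf 0 (v 0) (v 1) (v 2)) rfl (by rw [hnorm', hv])
    refine ⟨![y.imI, y.imJ, y.imK], by rw [hnorm y hy, hyn, hnorm'], ?_⟩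
    simp [hy] at hxy
    simp [dotProduct, Fin.sum_univ_three]
    linarith

open Quaternion in
theorem twinComplete_mul_sq_iff {n m : ℕ} (hn : Squarefree n) (hm : 0 < m) :
    TwinComplete (n * m ^ 2) ↔ TwinComplete n := by
  have hn0 : 0 < n := Nat.pos_of_ne_zero hn.ne_zero
  rw [twinComplete_iff hn0, twinComplete_iff (by positivity)]
  push_cast
  constructor
  · rintro ⟨h, x, hx, hnx⟩
    refine ⟨fun y hy hny => ?_, ?_⟩
    · by_contra ht
      obtain ⟨z, hz, hnz, hzt⟩ := exists_not_hasTwin_mul_sq hm hy hny ht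
        fun l hl _ => not_intDvd_of_squarefree hn hl hny
      exact hzt (h z hz hnz)
    · obtain ⟨z, hz, hnz, -⟩ := exists_normSq_of_mul_sq hm hx hnx
      exact ⟨z, hz, hnz⟩
  · rintro ⟨h, x, hx, hnx⟩
    refine ⟨fun y hy hny => ?_, (m : ℤ) • x, by rw [re_smul, hx, smul_zero], ?_⟩
    · obtain ⟨z, hz, hnz, ht⟩ := exists_normSq_of_mul_sq hm hy hny
      exact ht (h z hz hnz)
    · rw [normSq_zsmul, hnx, mul_comm]

theorem isSumOfPosSquares_two_le_iff {n : ℕ} (hn : 0 < n) :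
    (∃ k ≤ 2, IsSumOfPosSquares k n) ↔ ∃ a b : ℕ, a ^ 2 + b ^ 2 = n := by
  constructor
  · rintro ⟨k, hk, a, -, ha⟩
    interval_cases k
    · simp at ha; omega
    · exact ⟨a 0, 0, by simpa using ha⟩
    · exact ⟨a 0, a 1, by simpa using ha⟩
  · rintro ⟨a, b, h⟩
    have one : ∀ c : ℕ, c ^ 2 = n → ∃ k ≤ 2, IsSumOfPosSquares k n := by
      intro c hc
      refine ⟨1, one_le_two, ![c], fun i => ?_, by simpa using hc⟩
      fin_cases i
      exact Nat.pos_of_ne_zero (by rintro rfl; simp at hc; omega)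
    rcases Nat.eq_zero_or_pos a with rfl | ha
    · exact one b (by simpa using h)
    rcases Nat.eq_zero_or_pos b with rfl | hb
    · exact one a (by simpa using h)
    refine ⟨2, le_rfl, ![a, b], fun i => ?_, by simpa using h⟩
    fin_cases i
    exacts [ha, hb]

open Quaternion in
theorem twinComplete_iff_of_squarefree {n : ℕ} (hn : Squarefree n) :
    TwinComplete n ↔ (∃ k ≤ 2, IsSumOfPosSquares k n) ∧ ¬ IsSumOfPosSquares 3 n := by
  have hn0 : 0 < n := Nat.pos_of_ne_zero hn.ne_zero
  rw [twinComplete_iff hn0, isSumOfPosSquares_two_le_iff hn0]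
  constructor
  · rintro ⟨h, x, hx, hnx⟩
    refine ⟨?_, ?_⟩
    · have h0 := (h x hx hnx).exists_coord_eq_zero hn hx hnx
      rw [normSq_eq_sum, hx] at hnx
      have cast : ∀ b c : ℤ, b ^ 2 + c ^ 2 = n → ∃ a b : ℕ, a ^ 2 + b ^ 2 = n := by
        intro b c hbc
        refine ⟨b.natAbs, c.natAbs, ?_⟩
        zify
        simpa using hbc
      rcases h0 with h0 | h0 | h0 <;> rw [h0] at hnx
      · exact cast x.imJ x.imK (by linarith)
      · exact cast x.imI x.imK (by linarith)
      · exact cast x.imI x.imJ (by linarith)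
    · rintro ⟨a, hpos, ha⟩
      have hna : normSq (quatOf 0 (a 0) (a 1) (a 2)) = n := by
        rw [← ha, normSq_eq_sum]
        simp [Fin.sum_univ_three]
      have h0 := (h _ rfl hna).exists_coord_eq_zero hn rfl hna
      have p0 := hpos 0
      have p1 := hpos 1
      have p2 := hpos 2
      simp at h0
      omega
  · rintro ⟨⟨a, b, hab⟩, h3⟩
    refine ⟨fun x hx hnx => hasTwin_of_coord_eq_zero hx ?_, quatOf 0 a b 0, rfl, ?_⟩
    · by_contra! hne
      refine h3 ⟨![x.imI.natAbs, x.imJ.natAbs, x.imK.natAbs], fun i => ?_, ?_⟩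
      · fin_cases i
        exacts [Int.natAbs_pos.2 hne.1, Int.natAbs_pos.2 hne.2.1, Int.natAbs_pos.2 hne.2.2]
      · rw [normSq_eq_sum, hx] at hnx
        zify
        simp [Fin.sum_univ_three]
        linarith
    · rw [← hab, normSq_eq_sum]
      simp

theorem theorem1p8 :
    (∀ M : ℕ, 0 < M → (TwinComplete M ↔ TwinComplete (squarefreePart M))) ∧
    (∀ n : ℕ, 0 < n → Squarefree n →
      (TwinComplete n ↔
        (∃ k ≤ 2, IsSumOfPosSquares k n) ∧ ¬ IsSumOfPosSquares 3 n)) := by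
  refine ⟨fun M hM => ?_, fun n _ hn => twinComplete_iff_of_squarefree hn⟩
  obtain ⟨n, m, -, hm, rfl, hn⟩ := Nat.sq_mul_squarefree_of_pos hM
  rw [mul_comm, squarefreePart_eq hn hm]
  exact twinComplete_mul_sq_iff hn hm
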